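/- **Setting.** For $n$ clients with losses $f_1,\dots,f_n:\mathbb R^d\to\mathbb R$ and $\lambda>0$, personalized federated learning minimizes over $x=[x_1,\dots,x_n]\in\mathbb R^{nd}$ $$F(x)=\frac1n\sum_{i=1}^n f_i(x_i)+\frac{\lambda}{2n}\sum_{i=1}^n\|x_i-\bar x\|^2,\qquad \bar x=\frac1n\sum_{i=1}^n x_i ,$$ and $x^\star$ denotes the unique minimizer of $F$. Each loss is also given as a finite sum $f_i=\frac1m\sum_{j=1}^m\tilde f_{i,j}$. At each iteration $k$ an algorithm calls either the communication oracle or the local oracle. A local oracle call at $x^k$ returns to every client $i$ the set $\mathrm{Loc}(x^k,i)$, which is $\{\nabla f_i(x_i^k),\ \mathrm{prox}_{\beta_i f_i}(x_i^k)\}$ with $\beta_i\ge 0$ (proximal oracle), $\{\nabla f_i(x_i^k)\}$ (gradient oracle) or $\{\nabla \tilde f_{i,j_i}(x_i^k)\}$ with $1\le j_i\le m$ (summand gradient oracle); here $\mathrm{prox}_{\beta h}(x)=\arg\min_z\{\beta h(z)+\frac12\|z-x\|^2\}$, and $\beta_i,j_i$ may be chosen anew at each call. Put $S_i^0=\mathrm{Span}(x_i^0)$,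 and let $S_i^{k+1}=\mathrm{Span}(S_i^k,\mathrm{Loc}(x^k,i))$ if the local oracle is called at iteration $k$ and $S_i^{k+1}=\mathrm{Span}(S_1^k,\dots,S_n^k)$ if the clients communicate at iteration $k$. A *span algorithm* is one whose iterates always satisfy $x_i^k\in S_i^k$ for all $i$ and $k$. Let $C(k)$ be the number of communication oracle calls during the first $k$ iterations. Write $(t)_+=\max\{t,0\}$. **Theorem.** Let $n\ge2$, $m\ge1$. (a) Let $k\ge0$, $0<\mu<L_1$ and $\lambda\ge\mu$. There exist a dimension $d$, functions $f_1,\dots,f_n:\mathbb R^d\to\mathbb R$ that are $L_1$-smooth and $\mu$-strongly convex, with summands $\tilde f_{i,j}$ that are also $L_1$-smooth and $\mu$-strongly convex, and a starting point $x^0\ne x^\star$ in $\mathbb R^{nd}$, such that the iterates of any span algorithm, with any of the three local oracles, started at $x^0$, satisfy $$\|x^k-x^\star\|^2\ \ge\ \frac14\left(1-10\max\left\{\sqrt{\tfrac{\mu}{\lambda}},\sqrt{\tfrac{\mu}{L_1-\mu}}\right\}\right)_+^{C(k)+1}\|x^0-x^\star\|^2 .$$ (b) Consequently $\Omega\big(\sqrt{\min\{L_1,\lambda\}/\mu}\,\log\frac1\varepsilon\big)$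 communication rounds are necessary: there are universal constants $c>0$, $\kappa>1$ and $\varepsilon_0\in(0,1)$ such that, whenever $\mu>0$, $\min\{L_1,\lambda\}\ge\kappa\mu$ and $0<\varepsilon\le\varepsilon_0$, there exist $d$, $f_i$, $\tilde f_{i,j}$ and $x^0\ne x^\star$ as in (a) for which every span algorithm with any of the three local oracles, started at $x^0$, and every $k\ge0$ satisfy $$\|x^k-x^\star\|^2\le\varepsilon\|x^0-x^\star\|^2\ \Longrightarrow\ C(k)\ \ge\ c\,\sqrt{\frac{\min\{L_1,\lambda\}}{\mu}}\;\log\frac1\varepsilon .$$ -/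

import Mathlib

open scoped Gradient InnerProductSpace

noncomputable section

namespace PersonalizedFL

/-- Local models live in `ℝ^d` with the Euclidean norm. -/
abbrev Model (d : ℕ) : Type := EuclideanSpace ℝ (Fin d)

/-- Concatenations `x = [x_1, …, x_n]` of `n` local models, i.e. `ℝ^{nd}` with the Euclidean norm
`‖x‖² = ∑ i, ‖x_i‖²`. -/
abbrev Models (n d : ℕ) : Type := PiLp 2 (fun _ : Fin n => Model d)

/-- `h` is `L`-smooth: it is differentiable and
`h z' ≤ h z + ⟪∇ h z, z' - z⟫ + L / 2 * ‖z' - z‖ ^ 2` for all `z, z'`. -/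
def IsSmooth {d : ℕ} (L : ℝ) (h : Model d → ℝ) : Prop :=
  Differentiable ℝ h ∧
    ∀ z z' : Model d, h z' ≤ h z + ⟪∇ h z, z' - z⟫_ℝ + L / 2 * ‖z' - z‖ ^ 2

/-- The average `x̄ = (1/n) ∑ i, x_i` of the local models. -/
def average {n d : ℕ} (x : Models n d) : Model d :=
  (n : ℝ)⁻¹ • ∑ i, x i

/-- The personalized federated learning objective
`F x = (1/n) ∑ i, f_i (x_i) + lam / (2 n) * ∑ i, ‖x_i - x̄‖²`. -/
def objective {n d : ℕ} (lam : ℝ) (f : Fin n → Model d → ℝ) (x : Models n d) : ℝ :=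
  (n : ℝ)⁻¹ * ∑ i, f i (x i) + lam * (1 / (2 * (n : ℝ)) * ∑ i, ‖x i - average x‖ ^ 2)

/-- The values of the proximal operator `prox_{β h}` at `x`: the minimizers of
`z ↦ β * h z + ‖z - x‖² / 2` (there is exactly one if `h` is smooth and convex and `0 ≤ β`). -/
def proxSet {d : ℕ} (β : ℝ) (h : Model d → ℝ) (x : Model d) : Set (Model d) :=
  {p | ∀ z, β * h p + 1 / 2 * ‖p - x‖ ^ 2 ≤ β * h z + 1 / 2 * ‖z - x‖ ^ 2}

/-- The three kinds of local oracle. -/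
inductive OracleKind
  | proximal
  | gradient
  | summandGradient

/-- The vectors returned by one local oracle call at the point `x`, for a client with loss `h` and
summands `g_1, …, g_m` of that loss. The parameter `β` is used by the proximal oracle only, the
index `j` by the summand gradient oracle only. -/
def localOracle {m d : ℕ} (kind : OracleKind) (h : Model d → ℝ) (g : Fin m → Model d → ℝ)
    (β : ℝ) (j : Fin m) (x : Model d) : Set (Model d) :=
  match kind with
  | .proximal => {∇ h x} ∪ proxSet β h x
  | .gradient => {∇ h x}
  | .summandGradient => {∇ (g j) x}

/-- The subspaces `S_i^k`. Here `ans k i` is the set of vectors that the local oracle of client `i`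
returns at iteration `k`, and `isLocal k` says whether iteration `k` is a call of the local oracle
(`true`) or of the communication oracle (`false`). -/
def exploredSpan {n d : ℕ} (x₀ : Models n d) (isLocal : ℕ → Bool)
    (ans : ℕ → Fin n → Set (Model d)) : ℕ → Fin n → Submodule ℝ (Model d)
  | 0, i => Submodule.span ℝ {x₀ i}
  | k + 1, i =>
      if isLocal k then exploredSpan x₀ isLocal ans k i ⊔ Submodule.span ℝ (ans k i)
      else ⨆ l, exploredSpan x₀ isLocal ans k l

/-- An execution, started at `x₀`, of an algorithm whose iterates stay in the span of the observed
oracle outputs. Nothing else is required: the choice of oracle and of its parameters at each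
iteration, and of the iterates within the explored subspaces, is arbitrary, so every algorithm
(adaptive or not, deterministic or not) with that property produces such executions only. -/
structure Execution {n m d : ℕ} (kind : OracleKind) (f : Fin n → Model d → ℝ)
    (g : Fin n → Fin m → Model d → ℝ) (x₀ : Models n d) where
  /-- the iterates `x^0, x^1, …` -/
  x : ℕ → Models n d
  /-- whether the local oracle is called at iteration `k`; otherwise the clients communicate -/
  isLocal : ℕ → Bool
  /-- the proximal parameters -/
  β : ℕ → Fin n → ℝ
  /-- the indices of the queried summands -/
  j : ℕ → Fin n → Fin m
  β_nonneg : ∀ k i, 0 ≤ β k i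
  start : x 0 = x₀
  mem_span : ∀ k i, x k i ∈
    exploredSpan x₀ isLocal (fun t l => localOracle kind (f l) (g l) (β t l) (j t l) (x t l)) k i

/-- `C(k)`: the number of communication rounds among the first `k` iterations. -/
def Execution.commRounds {n m d : ℕ} {kind : OracleKind} {f : Fin n → Model d → ℝ}
    {g : Fin n → Fin m → Model d → ℝ} {x₀ : Models n d} (e : Execution kind f g x₀) (k : ℕ) : ℕ :=
  ((Finset.range k).filter (fun t => e.isLocal t = false)).card

/-- A problem instance with `n` clients, each of whose losses is the average of `m` summands,
together with a starting point that is not already the optimum. -/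
structure Instance (n m d : ℕ) (μ L lam : ℝ) where
  /-- the local losses -/
  f : Fin n → Model d → ℝ
  /-- the summands of the local losses -/
  g : Fin n → Fin m → Model d → ℝ
  /-- the starting point -/
  x₀ : Models n d
  /-- the optimum -/
  xstar : Models n d
  f_smooth : ∀ i, IsSmooth L (f i)
  f_strongConvex : ∀ i, StrongConvexOn Set.univ μ (f i)
  g_smooth : ∀ i j, IsSmooth L (g i j)
  g_strongConvex : ∀ i j, StrongConvexOn Set.univ μ (g i j)
  f_eq_average : ∀ i y, f i y = (m : ℝ)⁻¹ * ∑ j, g i j y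
  xstar_unique_min : ∀ x, x ≠ xstar → objective lam f xstar < objective lam f x
  start_ne : x₀ ≠ xstar

/-- The contraction factor `1 - 10 max {√(μ/lam), √(μ/(L-μ))}`, replaced by `0` if negative. -/
def rate (μ L lam : ℝ) : ℝ :=
  max 0 (1 - 10 * max (√(μ / lam)) (√(μ / (L - μ))))

end PersonalizedFL

end

noncomputable section

namespace PersonalizedFL

/-! ### Functions with an exact quadratic expansion -/

section QuadraticExpansion

variable {d : ℕ} {h : Model d → ℝ} {G : Model d → Model d} {q : Model d → ℝ} {m L : ℝ}

/-! The hard instance is a chain cut between two groups of clients. Every loss is a quadratic whose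
springs join neighbouring coordinates in disjoint pairs: one group holds the pairs (0,1), (2,3), …,
the other (1,2), (3,4), …, together with a force on coordinate 0. The penalty towards the average
couples equal coordinates of the two groups. Started at zero, a group can pass information only
across its own pairs, so each further coordinate costs a communication round. Gradients and proximal
points both respect this block structure, and taking all summands equal to the client's loss makes
the summand oracle a gradient oracle (`localOracle_matched_subset`, `Execution.mem_prefixSpace`).

Along the chain the optimum takes the values 1, σ, ρ, ρσ, ρ², …, alternating between the coupling
and a spring. Suitable end terms make this exact in finite dimension (`exists_chain_ratio`,
`chain_stationary`). After C rounds, the coordinates from C + 1 on are still zero and carry a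
fraction of order ρ^(2C) of the squared initial distance. Since 1 - ρ is at most 4 max(√(μ/lam),
√(μ/(L-μ))) when this maximum is at most 1/10, the rate follows (`exists_hard_instance`,
`exists_instance_rate_le`); logarithms turn it into the round count. -/

theorem hasGradientAt_of_expansion (hm : 0 ≤ m)
    (hG : ∀ z v, h (z + v) = h z + ⟪G z, v⟫_ℝ + q v)
    (hlow : ∀ v, m / 2 * ‖v‖ ^ 2 ≤ q v) (hup : ∀ v, q v ≤ L / 2 * ‖v‖ ^ 2) (z : Model d) :
    HasGradientAt h (G z) z := by
  rw [hasGradientAt_iff_isLittleO_nhds_zero]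
  have hq : (fun v => h (z + v) - h z - ⟪G z, v⟫_ℝ) = q := by
    funext v
    rw [hG]
    ring
  rw [hq]
  have hO : q =O[nhds 0] fun v : Model d => ‖v‖ ^ 2 := by
    refine Asymptotics.IsBigO.of_bound (L / 2) (Filter.Eventually.of_forall fun v => ?_)
    have h0 : 0 ≤ q v := le_trans (by positivity) (hlow v)
    rw [Real.norm_of_nonneg h0, Real.norm_of_nonneg (by positivity)]
    exact hup v
  exact hO.trans_isLittleO (Asymptotics.isLittleO_norm_pow_id one_lt_two)

theorem isSmooth_of_expansion (hm : 0 ≤ m)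
    (hG : ∀ z v, h (z + v) = h z + ⟪G z, v⟫_ℝ + q v)
    (hlow : ∀ v, m / 2 * ‖v‖ ^ 2 ≤ q v) (hup : ∀ v, q v ≤ L / 2 * ‖v‖ ^ 2) :
    IsSmooth L h := by
  have hgrad := hasGradientAt_of_expansion hm hG hlow hup
  refine ⟨fun z => (hgrad z).differentiableAt, fun z z' => ?_⟩
  have h1 := hG z (z' - z)
  rw [add_sub_cancel] at h1
  rw [(hgrad z).gradient, h1]
  linarith [hup (z' - z)]

theorem strongConvexOn_of_expansion
    (hG : ∀ z v, h (z + v) = h z + ⟪G z, v⟫_ℝ + q v)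
    (hlow : ∀ v, m / 2 * ‖v‖ ^ 2 ≤ q v) : StrongConvexOn Set.univ m h := by
  refine ⟨convex_univ, fun x _ y _ a b ha hb hab => ?_⟩
  obtain rfl : a = 1 - b := by linarith
  set z := (1 - b) • x + b • y with hz
  have e1 : x = z + b • (x - y) := by rw [hz]; module
  have e2 : y = z + (-(1 - b)) • (x - y) := by rw [hz]; module
  have h1 := hG z (b • (x - y))
  have h2 := hG z ((-(1 - b)) • (x - y))
  have l1 := hlow (b • (x - y))
  have l2 := hlow ((-(1 - b)) • (x - y))
  rw [← e1] at h1
  rw [← e2] at h2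
  rw [inner_smul_right] at h1 h2
  rw [norm_smul, mul_pow, Real.norm_eq_abs, sq_abs] at l1 l2
  simp only [smul_eq_mul]
  rw [h1, h2]
  nlinarith [mul_le_mul_of_nonneg_left l1 ha, mul_le_mul_of_nonneg_left l2 hb]

end QuadraticExpansion

/-! ### Minimizers of the objective -/

theorem sum_sub_average {n d : ℕ} (hn : 0 < n) (x : Models n d) :
    ∑ i, (x i - average x) = 0 := by
  have : (n : ℝ) ≠ 0 := by positivity
  rw [Finset.sum_sub_distrib, Finset.sum_const, Finset.card_univ, Fintype.card_fin, average,
    ← Nat.cast_smul_eq_nsmul ℝ, smul_smul, mul_inv_cancel₀ this, one_smul, sub_self]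

/-- A stationary point of the objective is its unique minimizer if the losses are strongly convex
in the sense of a quadratic lower bound at that point. -/
theorem objective_lt_of_stationary {n d : ℕ} (hn : 0 < n) {m lam : ℝ} (hm : 0 < m) (hlam : 0 ≤ lam)
    {f : Fin n → Model d → ℝ} {G : Fin n → Model d} {y : Models n d}
    (hf : ∀ i z, f i (y i) + ⟪G i, z - y i⟫_ℝ + m / 2 * ‖z - y i‖ ^ 2 ≤ f i z)
    (hG : ∀ i, G i + lam • (y i - average y) = 0) (x : Models n d) (hx : x ≠ y) :
    objective lam f y < objective lam f x := by
  have hn' : (0 : ℝ) < n := by exact_mod_cast hn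
  have key : ∀ i, f i (y i) + lam / 2 * ‖y i - average y‖ ^ 2 + m / 2 * ‖x i - y i‖ ^ 2
      + lam * ⟪y i - average y, average y - average x⟫_ℝ
      ≤ f i (x i) + lam / 2 * ‖x i - average x‖ ^ 2 := by
    intro i
    have h1 := hf i (x i)
    have h2 : G i = (-lam) • (y i - average y) := by
      rw [neg_smul]
      exact eq_neg_of_add_eq_zero_left (hG i)
    rw [h2, inner_smul_left] at h1
    simp only [conj_trivial] at h1
    have h3 : x i - average x = (y i - average y) + ((x i - y i) + (average y - average x)) := by
      abel
    rw [h3, norm_add_sq_real, inner_add_right]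
    nlinarith [mul_nonneg hlam (sq_nonneg ‖(x i - y i) + (average y - average x)‖)]
  have hsum := Finset.sum_le_sum fun i (_ : i ∈ Finset.univ) => key i
  -- The terms containing the shift of the average cancel, because deviations from an average sum to
  -- zero.
  simp only [Finset.sum_add_distrib, ← Finset.mul_sum, ← sum_inner, sum_sub_average hn,
    inner_zero_left, mul_zero, add_zero] at hsum
  have hpos : 0 < ∑ i, ‖x i - y i‖ ^ 2 := by
    have : ‖x - y‖ ^ 2 = ∑ i, ‖x i - y i‖ ^ 2 := PiLp.norm_sq_eq_of_L2 _ _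
    rw [← this]
    have := norm_pos_iff.2 (sub_ne_zero.2 hx)
    positivity
  have e : ∀ w : Models n d, objective lam f w
      = (n : ℝ)⁻¹ * (∑ i, f i (w i) + lam / 2 * ∑ i, ‖w i - average w‖ ^ 2) := by
    intro w
    rw [objective]
    field_simp
  rw [e, e]
  refine mul_lt_mul_of_pos_left ?_ (inv_pos.2 hn')
  nlinarith

/-! ### Quadratics on a matched set of coordinates -/

section Matching

variable {d : ℕ} (τ : Fin d → Fin d) (α a : ℝ) (c b : Fin d → ℝ)

/-- The quadratic with curvature `α + c j` at the coordinate `j`, linear part `b`, and springs of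
stiffness `a` between `j` and `τ j`. -/
def matchedLoss (x : Model d) : ℝ :=
  ∑ j, ((α + c j) / 2 * x j ^ 2 + a / 4 * (x j - x (τ j)) ^ 2 - b j * x j)

/-- The gradient of `matchedLoss`. -/
def matchedGrad (x : Model d) : Model d :=
  WithLp.toLp 2 fun j => (α + c j) * x j + a * (x j - x (τ j)) - b j

/-- The second order part of `matchedLoss`. -/
def matchedForm (v : Model d) : ℝ :=
  ∑ j, ((α + c j) / 2 * v j ^ 2 + a / 4 * (v j - v (τ j)) ^ 2)

variable {τ α a c b}

/-- The sum visits each pair from both ends, so the weight `a / 4` amounts to stiffness `a`.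
Reindexing by `τ` moves the force on `v (τ j)` onto `v j`. -/
theorem matchedLoss_add (hτ : Function.Involutive τ) (z v : Model d) :
    matchedLoss τ α a c b (z + v) = matchedLoss τ α a c b z + ⟪matchedGrad τ α a c b z, v⟫_ℝ
      + matchedForm τ α a c v := by
  have hre : ∑ j, (a / 2 * ((z j - z (τ j)) * v (τ j))) =
      ∑ j, (a / 2 * ((z (τ j) - z j) * v j)) := by
    refine Fintype.sum_bijective τ hτ.bijective _ _ fun j => ?_
    rw [hτ j]
  have hin : ⟪matchedGrad τ α a c b z, v⟫_ℝ
      = ∑ j, ((α + c j) * z j + a * (z j - z (τ j)) - b j) * v j := by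
    rw [PiLp.inner_apply]
    refine Finset.sum_congr rfl fun j _ => ?_
    simp [matchedGrad, mul_comm]
  have h0 : ∑ j, (a / 2 * ((z j - z (τ j)) * v (τ j)) - a / 2 * ((z (τ j) - z j) * v j)) = 0 := by
    rw [Finset.sum_sub_distrib, hre, sub_self]
  rw [hin, matchedLoss, matchedLoss, matchedForm, ← Finset.sum_add_distrib,
    ← Finset.sum_add_distrib, ← sub_eq_zero, ← Finset.sum_sub_distrib, ← neg_eq_zero,
    ← Finset.sum_neg_distrib, ← h0]
  refine Finset.sum_congr rfl fun j _ => ?_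
  simp only [PiLp.add_apply]
  ring

theorem le_matchedForm (ha : 0 ≤ a) (hc : ∀ j, 0 ≤ c j) (v : Model d) :
    α / 2 * ‖v‖ ^ 2 ≤ matchedForm τ α a c v := by
  rw [EuclideanSpace.real_norm_sq_eq, matchedForm, Finset.mul_sum]
  refine Finset.sum_le_sum fun j _ => ?_
  nlinarith [mul_nonneg (hc j) (sq_nonneg (v j)), mul_nonneg ha (sq_nonneg (v j - v (τ j)))]

/-- A spring adds curvature at most `2 * a`, by (u - w)² ≤ 2u² + 2w². The extra curvature `c` lives
only at fixed points of `τ`, where no spring acts, so the two never add up. -/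
theorem matchedForm_le (hτ : Function.Involutive τ) (ha : 0 ≤ a)
    (hc : ∀ j, c j ≤ 2 * a) (hfix : ∀ j, τ j ≠ j → c j = 0) (v : Model d) :
    matchedForm τ α a c v ≤ (α + 2 * a) / 2 * ‖v‖ ^ 2 := by
  have hre : ∑ j, a / 2 * v (τ j) ^ 2 = ∑ j, a / 2 * v j ^ 2 :=
    Fintype.sum_bijective τ hτ.bijective _ _ fun j => rfl
  calc matchedForm τ α a c v
      ≤ ∑ j, ((α + a) / 2 * v j ^ 2 + a / 2 * v (τ j) ^ 2) := by
        refine Finset.sum_le_sum fun j _ => ?_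
        by_cases hj : τ j = j
        · rw [hj]
          nlinarith [mul_le_mul_of_nonneg_right (hc j) (sq_nonneg (v j))]
        · rw [hfix j hj]
          nlinarith [mul_nonneg ha (sq_nonneg (v j + v (τ j)))]
    _ = (α + 2 * a) / 2 * ‖v‖ ^ 2 := by
        rw [Finset.sum_add_distrib, hre, ← Finset.sum_add_distrib,
          EuclideanSpace.real_norm_sq_eq, Finset.mul_sum]
        exact Finset.sum_congr rfl fun j _ => by ring

/-- The vectors whose coordinates from `K` on vanish. -/
def prefixSpace (d K : ℕ) : Submodule ℝ (Model d) where
  carrier := {x | ∀ j : Fin d, K ≤ j → x j = 0}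
  zero_mem' := by simp
  add_mem' := fun hx hy j hj => by simp [hx j hj, hy j hj]
  smul_mem' := fun r x hx j hj => by simp [hx j hj]

theorem prefixSpace_mono {K K' : ℕ} (h : K ≤ K') : prefixSpace d K ≤ prefixSpace d K' :=
  fun _ hx j hj => hx j (h.trans hj)

theorem matchedGrad_mem {K : ℕ} (hK : ∀ j : Fin d, K ≤ j → K ≤ τ j)
    (hb : ∀ j : Fin d, K ≤ j → b j = 0) {x : Model d} (hx : x ∈ prefixSpace d K) :
    matchedGrad τ α a c b x ∈ prefixSpace d K := by
  intro j hj
  simp [matchedGrad, hx j hj, hx _ (hK j hj), hb j hj]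

/-- Zeroing the coordinates of `p` from `K` on does not raise the loss, since no pair straddles `K`
and no force acts there, while it lowers the squared distance to `x` by exactly the squared tail. A
minimizer therefore has no tail, even for `β = 0`. -/
theorem prox_matchedLoss_mem (hτ : Function.Involutive τ) (hα : 0 ≤ α) (ha : 0 ≤ a)
    (hc : ∀ j, 0 ≤ c j) {K : ℕ}
    (hK : ∀ j : Fin d, K ≤ j → K ≤ τ j) (hb : ∀ j : Fin d, K ≤ j → b j = 0) {β : ℝ} (hβ : 0 ≤ β)
    {x p : Model d} (hx : x ∈ prefixSpace d K) (hp : p ∈ proxSet β (matchedLoss τ α a c b) x) :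
    p ∈ prefixSpace d K := by
  set p' : Model d := WithLp.toLp 2 fun j => if K ≤ (j : ℕ) then 0 else p j with hp'
  have hp'j : ∀ j, p' j = if K ≤ (j : ℕ) then 0 else p j := fun j => rfl
  have hloss : matchedLoss τ α a c b p' ≤ matchedLoss τ α a c b p := by
    refine Finset.sum_le_sum fun j _ => ?_
    by_cases hj : K ≤ (j : ℕ)
    · rw [hp'j, hp'j, if_pos hj, if_pos (hK j hj), hb j hj]
      have := hc j
      have : 0 ≤ (α + c j) / 2 * p j ^ 2 + a / 4 * (p j - p (τ j)) ^ 2 := by positivity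
      linarith
    · have hj' : ¬ K ≤ (τ j : ℕ) := fun h => hj (by simpa [hτ j] using hK _ h)
      rw [hp'j, hp'j, if_neg hj, if_neg hj']
  have hnorm : ‖p - x‖ ^ 2 = ‖p' - x‖ ^ 2 + ∑ j, (p j - p' j) ^ 2 := by
    rw [EuclideanSpace.real_norm_sq_eq, EuclideanSpace.real_norm_sq_eq, ← Finset.sum_add_distrib]
    refine Finset.sum_congr rfl fun j _ => ?_
    simp only [PiLp.sub_apply, hp'j]
    split_ifs with hj
    · rw [hx j hj]
      ring
    · ring
  have hle := hp p'
  have hzero : ∑ j, (p j - p' j) ^ 2 ≤ 0 := by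
    nlinarith [mul_le_mul_of_nonneg_left hloss hβ]
  intro j hj
  have h1 := (Finset.single_le_sum (f := fun j => (p j - p' j) ^ 2)
    (fun j _ => sq_nonneg _) (Finset.mem_univ j)).trans hzero
  simp only [hp'j, if_pos hj, sub_zero] at h1
  exact pow_eq_zero_iff two_ne_zero |>.1 (le_antisymm h1 (sq_nonneg _))

end Matching

/-! ### Coordinates reachable by an execution -/

theorem Execution.commRounds_succ {n m d : ℕ} {kind : OracleKind} {f : Fin n → Model d → ℝ}
    {g : Fin n → Fin m → Model d → ℝ} {x₀ : Models n d} (e : Execution kind f g x₀) (k : ℕ) :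
    e.commRounds (k + 1) = e.commRounds k + if e.isLocal k then 0 else 1 := by
  unfold Execution.commRounds
  rw [Finset.range_add_one, Finset.filter_insert]
  by_cases h : e.isLocal k
  · simp [h]
  · simp [h]

theorem Execution.commRounds_le {n m d : ℕ} {kind : OracleKind} {f : Fin n → Model d → ℝ}
    {g : Fin n → Fin m → Model d → ℝ} {x₀ : Models n d} (e : Execution kind f g x₀) (k : ℕ) :
    e.commRounds k ≤ k :=
  (Finset.card_filter_le _ _).trans (Finset.card_range k).le

/-- If `reach i C` coordinates are invariant under the oracles of client `i`, and a communication
round unlocks no more than the next value of `reach`, then the number of communication rounds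
controls the nonzero coordinates of the iterates. -/
theorem Execution.mem_prefixSpace {n m d : ℕ} {kind : OracleKind} {f : Fin n → Model d → ℝ}
    {g : Fin n → Fin m → Model d → ℝ} {x₀ : Models n d} (e : Execution kind f g x₀)
    (hx₀ : ∀ i, x₀ i = 0) (reach : Fin n → ℕ → ℕ)
    (hreach : ∀ l i C, reach l C ≤ reach i (C + 1))
    (horacle : ∀ i C β j x, 0 ≤ β → x ∈ prefixSpace d (reach i C) →
      localOracle kind (f i) (g i) β j x ⊆ prefixSpace d (reach i C)) (k : ℕ) (i : Fin n) :
    e.x k i ∈ prefixSpace d (reach i (e.commRounds k)) := by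
  suffices H : ∀ k i, exploredSpan x₀ e.isLocal (fun t l =>
      localOracle kind (f l) (g l) (e.β t l) (e.j t l) (e.x t l)) k i
        ≤ prefixSpace d (reach i (e.commRounds k)) from H k i (e.mem_span k i)
  intro k
  induction k with
  | zero =>
    intro i
    simp [exploredSpan, hx₀]
  | succ k ih =>
    intro i
    rw [exploredSpan, e.commRounds_succ]
    by_cases hk : e.isLocal k
    · rw [if_pos hk, if_pos hk, add_zero]
      refine sup_le (ih i) (Submodule.span_le.2 ?_)
      exact horacle i _ _ _ _ (e.β_nonneg k i) (ih i (e.mem_span k i))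
    · rw [if_neg hk, if_neg hk]
      exact iSup_le fun l => (ih l).trans (prefixSpace_mono (hreach l i _))

/-! ### Instances with matched losses -/

theorem exists_matched_instance {n m d : ℕ} (hn : 0 < n) (hm : 0 < m) {μ L lam : ℝ} (hμ : 0 < μ)
    (hlam : 0 ≤ lam) {τ : Fin n → Fin d → Fin d} {α a : Fin n → ℝ} {c b : Fin n → Fin d → ℝ}
    (hτ : ∀ i, Function.Involutive (τ i)) (hα : ∀ i, μ ≤ α i) (ha : ∀ i, 0 ≤ a i)
    (hL : ∀ i, α i + 2 * a i ≤ L) (hc : ∀ i j, 0 ≤ c i j) (hca : ∀ i j, c i j ≤ 2 * a i)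
    (hfix : ∀ i j, τ i j ≠ j → c i j = 0) {x₀ y : Models n d} (hx₀ : x₀ ≠ y)
    (hy : ∀ i, matchedGrad (τ i) (α i) (a i) (c i) (b i) (y i) + lam • (y i - average y) = 0) :
    ∃ P : Instance n m d μ L lam, P.x₀ = x₀ ∧ P.xstar = y ∧
      (∀ i, P.f i = matchedLoss (τ i) (α i) (a i) (c i) (b i)) ∧ ∀ i j, P.g i j = P.f i := by
  have hadd := fun i => matchedLoss_add (α := α i) (a := a i) (c := c i) (b := b i) (hτ i)
  have hlow : ∀ i v, μ / 2 * ‖v‖ ^ 2 ≤ matchedForm (τ i) (α i) (a i) (c i) v := fun i v =>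
    (mul_le_mul_of_nonneg_right (by linarith [hα i]) (sq_nonneg _)).trans
      (le_matchedForm (ha i) (hc i) v)
  have hup : ∀ i v, matchedForm (τ i) (α i) (a i) (c i) v ≤ L / 2 * ‖v‖ ^ 2 := fun i v =>
    (matchedForm_le (hτ i) (ha i) (hca i) (hfix i) v).trans
      (mul_le_mul_of_nonneg_right (by linarith [hL i]) (sq_nonneg _))
  have hsm := fun i => isSmooth_of_expansion hμ.le (hadd i) (hlow i) (hup i)
  have hsc := fun i => strongConvexOn_of_expansion (hadd i) (hlow i)
  refine ⟨⟨fun i => matchedLoss (τ i) (α i) (a i) (c i) (b i),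
    fun i _ => matchedLoss (τ i) (α i) (a i) (c i) (b i), x₀, y, hsm, hsc, fun i _ => hsm i,
    fun i _ => hsc i, fun i z => ?_, ?_, hx₀⟩, rfl, rfl, fun _ => rfl, fun _ _ => rfl⟩
  · have : (m : ℝ) ≠ 0 := by positivity
    simp [this]
  · refine objective_lt_of_stationary hn hμ hlam (fun i z => ?_) hy
    have h1 := hadd i (y i) (z - y i)
    rw [add_sub_cancel] at h1
    linarith [hlow i (z - y i)]

theorem localOracle_matched_subset {m d : ℕ} (kind : OracleKind) {h : Model d → ℝ}
    {g : Fin m → Model d → ℝ} {τ : Fin d → Fin d} {α a : ℝ} {c b : Fin d → ℝ}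
    (hh : h = matchedLoss τ α a c b) (hg : ∀ j, g j = h)
    (hτ : Function.Involutive τ) (hα : 0 ≤ α) (ha : 0 ≤ a) (hc : ∀ j, 0 ≤ c j)
    (hca : ∀ j, c j ≤ 2 * a) (hfix : ∀ j, τ j ≠ j → c j = 0) {K : ℕ}
    (hK : ∀ j : Fin d, K ≤ j → K ≤ τ j) (hb : ∀ j : Fin d, K ≤ j → b j = 0)
    {β : ℝ} (hβ : 0 ≤ β) (j : Fin m) {x : Model d} (hx : x ∈ prefixSpace d K) :
    localOracle kind h g β j x ⊆ prefixSpace d K := by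
  have hgrad : ∇ h x ∈ prefixSpace d K := by
    rw [hh, (hasGradientAt_of_expansion hα (matchedLoss_add hτ) (le_matchedForm ha hc)
      (matchedForm_le hτ ha hca hfix) x).gradient]
    exact matchedGrad_mem hK hb hx
  cases kind with
  | proximal =>
    refine Set.union_subset (Set.singleton_subset_iff.2 hgrad) fun p hp => ?_
    rw [hh] at hp
    exact prox_matchedLoss_mem hτ hα ha hc hK hb hβ hx hp
  | gradient => exact Set.singleton_subset_iff.2 hgrad
  | summandGradient =>
    refine Set.singleton_subset_iff.2 ?_
    rw [hg]
    exact hgrad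

/-! ### The chain -/

/-- The matching of `0, …, d - 1` that joins `j` to `j + 1` whenever `j + s` is even. -/
def pairing (d s : ℕ) (j : Fin d) : Fin d :=
  if (j + s) % 2 = 0 then (if h : (j : ℕ) + 1 < d then ⟨j + 1, h⟩ else j)
  else ⟨j - 1, by omega⟩

/-- Unmatched ends are fixed points: truncated subtraction keeps 0 in place when `s` is odd, and the
last coordinate stays when its partner would lie outside. -/
theorem pairing_involutive (d s : ℕ) : Function.Involutive (pairing d s) := by
  intro j
  have := j.2
  ext
  unfold pairing
  by_cases h : ((j : ℕ) + s) % 2 = 0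
  · by_cases h1 : (j : ℕ) + 1 < d
    · have h2 : ¬ ((j : ℕ) + 1 + s) % 2 = 0 := by omega
      simp [h, h1, h2]
    · simp [h, h1]
  · by_cases h1 : (j : ℕ) = 0
    · simp [h1]
      simp [h1] at h
      simp [h]
    · have h2 : ((j : ℕ) - 1 + s) % 2 = 0 := by omega
      have h3 : (j : ℕ) - 1 + 1 = j := by omega
      simp [h, h2, h3]

theorem le_pairing {d s K : ℕ} (hK : (K + s) % 2 = 0) (j : Fin d) (hj : K ≤ j) :
    K ≤ pairing d s j := by
  unfold pairing
  split_ifs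
  · simp only
    omega
  · exact hj
  · simp only
    omega

/-- The extra curvature at the two ends of the chain. -/
def endCurvature (d s : ℕ) (A E : ℝ) (j : Fin d) : ℝ :=
  if (j + s) % 2 = 0 then (if (j : ℕ) + 1 < d then 0 else E) else if (j : ℕ) = 0 then A else 0

/-- The linear part of the losses, which sits at the start of the chain. -/
def startForce (d s : ℕ) (w : ℝ) (j : Fin d) : ℝ :=
  if (j + s) % 2 = 0 then 0 else if (j : ℕ) = 0 then w else 0

/-- The optimum of the clients of kind `s`. -/
def chainOpt (d s : ℕ) (ρ σ : ℝ) : Model d :=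
  WithLp.toLp 2 fun j => ρ ^ (j : ℕ) * if (j + s) % 2 = 0 then σ else 1

theorem endCurvature_eq_zero {d s : ℕ} {A E : ℝ} {j : Fin d} (h : pairing d s j ≠ j) :
    endCurvature d s A E j = 0 := by
  unfold endCurvature
  unfold pairing at h
  split_ifs with h1 h2 h3
  · rfl
  · simp [h1, h2] at h
  · simp only [h1, if_false] at h
    exact absurd (Fin.ext (by simp [h3])) h
  · rfl

theorem startForce_eq_zero {d s K : ℕ} {w : ℝ} (hK : (K + s) % 2 = 0) (j : Fin d) (hj : K ≤ j) :
    startForce d s w j = 0 := by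
  unfold startForce
  split_ifs
  · rfl
  · omega
  · rfl

/-- Solving the first balance equation for σ turns the second into (1 - ρ)² = ρt; its smaller root
lies in (0, 1). -/
theorem exists_chain_ratio {μ A B : ℝ} (hμ : 0 < μ) (hA : 0 < A) (hB : 0 < B) :
    ∃ ρ σ : ℝ, 0 < ρ ∧ ρ < σ ∧ σ < 1 ∧ μ * σ + A * (σ - ρ) + B * (σ - 1) = 0 ∧
      μ * ρ + A * (ρ - σ) + B * ρ * (1 - σ) = 0 ∧
      (1 - ρ) ^ 2 = ρ * (2 * μ / A + 2 * μ / B + μ / A * (μ / B)) := by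
  set t := 2 * μ / A + 2 * μ / B + μ / A * (μ / B) with ht
  have ht0 : 0 < t := by positivity
  have hsq : √(t ^ 2 + 4 * t) ^ 2 = t ^ 2 + 4 * t := Real.sq_sqrt (by positivity)
  set r := √(t ^ 2 + 4 * t) with hr
  have hr0 : 0 ≤ r := Real.sqrt_nonneg _
  have hr1 : r < 2 + t := by nlinarith
  have hr2 : t < r := by nlinarith
  obtain ⟨ρ, hρ⟩ : ∃ ρ, ρ = (2 + t - r) / 2 := ⟨_, rfl⟩
  have hρ0 : 0 < ρ := by linarith
  have hρ1 : ρ < 1 := by linarith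
  have hq : (1 - ρ) ^ 2 = ρ * t := by
    rw [hρ]
    linear_combination hsq / 4
  have hq' : A * B * (1 - ρ) ^ 2 = ρ * (2 * μ * B + 2 * μ * A + μ ^ 2) := by
    rw [hq, ht]
    field_simp
  have hS : 0 < μ + A + B := by positivity
  obtain ⟨σ, hσ⟩ : ∃ σ, σ = (B + A * ρ) / (μ + A + B) := ⟨_, rfl⟩
  have hσ' : σ * (μ + A + B) = B + A * ρ := by
    rw [hσ]
    field_simp
  have hσ1 : σ < 1 := by
    rw [hσ, div_lt_one hS]
    nlinarith
  have hdown : μ * ρ + A * (ρ - σ) + B * ρ * (1 - σ) = 0 := by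
    refine (mul_eq_zero.1 (?_ : (μ + A + B) * _ = 0)).resolve_left hS.ne'
    linear_combination (-(A + B * ρ)) * hσ' - hq'
  refine ⟨ρ, σ, hρ0, ?_, hσ1, by linarith, hdown, hq⟩
  nlinarith [mul_pos hμ hρ0, mul_pos (mul_pos hB hρ0) (sub_pos.2 hσ1)]

/-- In the interior this is a power of ρ times a balance equation. The end terms replace the missing
springs: curvature A(1 - ρ/σ) imitates a next value ρ^d, and curvature A with force Aσ/ρ imitates a
previous value σ/ρ. -/
theorem chain_stationary {d s s' : ℕ} {μ A B ρ σ : ℝ} (hs : (s + s') % 2 = 1) (hρ : ρ ≠ 0)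
    (hσ : σ ≠ 0) (hup : μ * σ + A * (σ - ρ) + B * (σ - 1) = 0)
    (hdown : μ * ρ + A * (ρ - σ) + B * ρ * (1 - σ) = 0) (j : Fin d) :
    (μ + endCurvature d s A (A * (1 - ρ / σ)) j) * chainOpt d s ρ σ j
      + A * (chainOpt d s ρ σ j - chainOpt d s ρ σ (pairing d s j))
      - startForce d s (A * (σ / ρ)) j
      + B * (chainOpt d s ρ σ j - chainOpt d s' ρ σ j) = 0 := by
  simp only [chainOpt, endCurvature, startForce, pairing]
  by_cases h : ((j : ℕ) + s) % 2 = 0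
  · have h' : ¬ ((j : ℕ) + s') % 2 = 0 := by omega
    by_cases h1 : (j : ℕ) + 1 < d
    · have h2 : ¬ ((j : ℕ) + 1 + s) % 2 = 0 := by omega
      simp only [h, h', h1, h2, if_true, if_false, dif_pos]
      linear_combination ρ ^ (j : ℕ) * hup
    · simp only [h, h', h1, if_true, if_false, dif_neg, not_false_eq_true]
      field_simp
      linear_combination ρ ^ (j : ℕ) * hup
  · have h' : ((j : ℕ) + s') % 2 = 0 := by omega
    by_cases h1 : (j : ℕ) = 0
    · simp only [h1, zero_add] at h h'
      simp only [h1, h, h', zero_add, if_true, if_false, Nat.zero_sub, pow_zero]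
      field_simp
      linear_combination hdown
    · obtain ⟨i, hi⟩ := Nat.exists_eq_succ_of_ne_zero h1
      have h2 : ((j : ℕ) - 1 + s) % 2 = 0 := by omega
      simp only [h, h', h1, h2, if_true, if_false]
      rw [hi, Nat.succ_sub_one, Nat.succ_eq_add_one, pow_succ]
      linear_combination ρ ^ i * hdown

/-! ### The two groups of clients -/

/-- The first half of the clients is of kind `1`, the others of kind `0`. -/
def clientKind {n : ℕ} (i : Fin n) : ℕ := if (i : ℕ) < n / 2 then 1 else 0

theorem sum_clientKind {n : ℕ} {M : Type*} [AddCommGroup M] [Module ℝ M] (Y : ℕ → M) :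
    ∑ i : Fin n, Y (clientKind i) = ((n / 2 : ℕ) : ℝ) • Y 1 + ((n : ℝ) - (n / 2 : ℕ)) • Y 0 := by
  have hle : n / 2 ≤ n := Nat.div_le_self n 2
  have h1 : ∑ i : Fin n, Y (clientKind i)
      = ∑ i ∈ Finset.range n, if i < n / 2 then Y 1 else Y 0 := by
    rw [Finset.sum_range]
    exact Finset.sum_congr rfl fun i _ => apply_ite Y _ _ _
  have h2 : (Finset.range n).filter (fun i => i < n / 2) = Finset.range (n / 2) := by
    ext i
    simp
    omega
  have h3 := Finset.card_filter_add_card_filter_not (s := Finset.range n) (fun i => i < n / 2)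
  rw [h2, Finset.card_range, Finset.card_range] at h3
  have h4 : ((Finset.range n).filter (fun i => ¬ i < n / 2)).card = n - n / 2 := by omega
  rw [h1, Finset.sum_ite, Finset.sum_const, Finset.sum_const, h2, Finset.card_range, h4,
    ← Nat.cast_smul_eq_nsmul ℝ, ← Nat.cast_smul_eq_nsmul ℝ, Nat.cast_sub hle]

/-- Rescaling of the losses that makes up for groups of different sizes. -/
def clientScale (n s : ℕ) : ℝ :=
  if s = 1 then ((n : ℝ) - (n / 2 : ℕ)) / (n / 2 : ℕ) else 1

/-- The joint optimum of the chain. -/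
def chainOptimum (n d : ℕ) (ρ σ : ℝ) : Models n d :=
  WithLp.toLp 2 fun i => chainOpt d (clientKind i) ρ σ

theorem clientKind_eq {n : ℕ} (i : Fin n) : clientKind i = 1 ∨ clientKind i = 0 := by
  unfold clientKind
  split_ifs <;> simp

theorem clientScale_mem {n : ℕ} (hn : 2 ≤ n) (s : ℕ) :
    1 ≤ clientScale n s ∧ clientScale n s ≤ 2 := by
  have h1 : 0 < n / 2 := by omega
  have h2 : n ≤ 3 * (n / 2) := by omega
  have h3 : 2 * (n / 2) ≤ n := by omega
  have h1' : (0 : ℝ) < (n / 2 : ℕ) := by exact_mod_cast h1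
  have h2' : (n : ℝ) ≤ 3 * (n / 2 : ℕ) := by exact_mod_cast h2
  have h3' : 2 * ((n / 2 : ℕ) : ℝ) ≤ n := by exact_mod_cast h3
  unfold clientScale
  split_ifs
  · rw [le_div_iff₀ h1', div_le_iff₀ h1']
    constructor <;> linarith
  · norm_num

/-- With h = `n / 2`, the deviation from the average is h/n times the difference of the groups for
kind 0, and (n - h)/n times it for kind 1. `clientScale` is the quotient of these factors, so both
kinds see the coupling B = lam h/n. -/
theorem chainOptimum_stationary {n d : ℕ} (hn : 2 ≤ n) {μ A lam ρ σ : ℝ} (hρ : ρ ≠ 0) (hσ : σ ≠ 0)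
    (hup : μ * σ + A * (σ - ρ) + lam * (n / 2 : ℕ) / n * (σ - 1) = 0)
    (hdown : μ * ρ + A * (ρ - σ) + lam * (n / 2 : ℕ) / n * ρ * (1 - σ) = 0) (i : Fin n) :
    matchedGrad (pairing d (clientKind i)) (clientScale n (clientKind i) * μ)
      (clientScale n (clientKind i) * A)
      (fun j => clientScale n (clientKind i) *
        endCurvature d (clientKind i) A (A * (1 - ρ / σ)) j)
      (fun j => clientScale n (clientKind i) * startForce d (clientKind i) (A * (σ / ρ)) j)
      (chainOptimum n d ρ σ i)
      + lam • (chainOptimum n d ρ σ i - average (chainOptimum n d ρ σ)) = 0 := by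
  have hn' : (n : ℝ) ≠ 0 := by positivity
  have h1 : ((n / 2 : ℕ) : ℝ) ≠ 0 := by
    have : 0 < n / 2 := by omega
    positivity
  have havg : average (chainOptimum n d ρ σ) = (n : ℝ)⁻¹ • (((n / 2 : ℕ) : ℝ) • chainOpt d 1 ρ σ
      + ((n : ℝ) - (n / 2 : ℕ)) • chainOpt d 0 ρ σ) := by
    rw [average]
    congr 1
    exact sum_clientKind fun s => chainOpt d s ρ σ
  ext j
  rw [havg]
  simp only [chainOptimum, matchedGrad, PiLp.add_apply, PiLp.smul_apply, PiLp.sub_apply,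
    smul_eq_mul, PiLp.zero_apply]
  rcases clientKind_eq i with h | h
  · have key := chain_stationary (s := 1) (s' := 0) rfl hρ hσ hup hdown j
    rw [h, clientScale, if_pos rfl]
    linear_combination (norm := skip) ((n : ℝ) - (n / 2 : ℕ)) / (n / 2 : ℕ) * key
    field_simp
    ring
  · have key := chain_stationary (s := 0) (s' := 1) rfl hρ hσ hup hdown j
    rw [h, clientScale, if_neg zero_ne_one]
    linear_combination (norm := skip) key
    field_simp
    ring

theorem endCurvature_mem {d s : ℕ} {A E : ℝ} (hA : 0 ≤ A) (hE : 0 ≤ E) (hEA : E ≤ A) (j : Fin d) :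
    0 ≤ endCurvature d s A E j ∧ endCurvature d s A E j ≤ A := by
  unfold endCurvature
  split_ifs <;> constructor <;> linarith

theorem norm_chainOptimum_sq_le {n d : ℕ} {ρ σ : ℝ} (hρ : 0 < ρ) (hσ : 0 < σ) (hσ1 : σ < 1) :
    ‖chainOptimum n d ρ σ‖ ^ 2 ≤ n * ∑ j ∈ Finset.range d, (ρ ^ 2) ^ j := by
  have h : ∀ i, ‖chainOptimum n d ρ σ i‖ ^ 2 ≤ ∑ j ∈ Finset.range d, (ρ ^ 2) ^ j := by
    intro i
    rw [EuclideanSpace.real_norm_sq_eq, Finset.sum_range]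
    refine Finset.sum_le_sum fun j _ => ?_
    simp only [chainOptimum, chainOpt]
    rw [mul_pow, ← pow_mul, ← pow_mul, mul_comm 2]
    refine mul_le_of_le_one_right (by positivity) ?_
    split_ifs
    · nlinarith
    · norm_num
  rw [PiLp.norm_sq_eq_of_L2]
  calc _ ≤ ∑ _i : Fin n, ∑ j ∈ Finset.range d, (ρ ^ 2) ^ j := Finset.sum_le_sum fun i _ => h i
    _ = _ := by simp

theorem le_norm_sub_chainOptimum_sq {n d D : ℕ} {ρ σ : ℝ} (hρ : 0 < ρ) (hρσ : ρ ≤ σ) (hσ1 : σ ≤ 1)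
    {x : Models n (D + d)} (hx : ∀ i, x i ∈ prefixSpace (D + d) D) :
    n * (ρ ^ 2 * (ρ ^ 2) ^ D * ∑ j ∈ Finset.range d, (ρ ^ 2) ^ j)
      ≤ ‖x - chainOptimum n (D + d) ρ σ‖ ^ 2 := by
  have h : ∀ i, ρ ^ 2 * (ρ ^ 2) ^ D * ∑ j ∈ Finset.range d, (ρ ^ 2) ^ j
      ≤ ‖x i - chainOptimum n (D + d) ρ σ i‖ ^ 2 := by
    intro i
    rw [EuclideanSpace.real_norm_sq_eq, Fin.sum_univ_add, Finset.sum_range, Finset.mul_sum]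
    refine le_add_of_nonneg_of_le (Finset.sum_nonneg fun j _ => sq_nonneg _)
      (Finset.sum_le_sum fun j _ => ?_)
    -- A missing coordinate `D + j` costs at least ρ^(D + j + 1), as its factor σ or 1 is at least
    -- ρ.
    have h0 : x i (Fin.natAdd D j) = 0 := hx i _ (by simp)
    have h1 : ρ ≤ if ((Fin.natAdd D j : Fin (D + d)) + clientKind i : ℕ) % 2 = 0 then σ else 1 := by
      split_ifs <;> linarith
    simp only [PiLp.sub_apply, h0, chainOptimum, chainOpt]
    rw [zero_sub, neg_sq, mul_pow, mul_assoc, ← pow_add, ← pow_mul, ← pow_mul, mul_comm,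
      mul_comm 2, Fin.val_natAdd]
    exact mul_le_mul_of_nonneg_left (pow_le_pow_left₀ hρ.le h1 2) (by positivity)
  rw [PiLp.norm_sq_eq_of_L2]
  calc _ = ∑ _i : Fin n, ρ ^ 2 * (ρ ^ 2) ^ D * ∑ j ∈ Finset.range d, (ρ ^ 2) ^ j := by simp
    _ ≤ _ := Finset.sum_le_sum fun i _ => h i

theorem geom_sum_le_two_mul {r : ℝ} (hr : 0 ≤ r) (hr1 : r < 1) {N d : ℕ} (hN : r ^ N ≤ 1 / 2)
    (hd : N ≤ d) (d' : ℕ) :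
    ∑ j ∈ Finset.range d', r ^ j ≤ 2 * ∑ j ∈ Finset.range d, r ^ j := by
  have h : 0 < 1 - r := by linarith
  have e := mul_neg_geom_sum r d
  have e' := mul_neg_geom_sum r d'
  have h1 : r ^ d ≤ 1 / 2 := (pow_le_pow_of_le_one hr hr1.le hd).trans hN
  have h2 : 0 ≤ r ^ d' := by positivity
  refine le_of_mul_le_mul_left ?_ h
  linarith

/-- A lower bound that contracts by at most `ρ ^ 2` per communication round, where `ρ` is the decay
of the optimum along the chain. -/
theorem exists_hard_instance {μ L lam M : ℝ} (hμ : 0 < μ) (hM0 : 0 ≤ M)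
    (hM : M ≤ 1 / 10) (hlamM : μ ≤ M ^ 2 * lam) (hLM : μ ≤ M ^ 2 * (L - μ)) {n m : ℕ} (hn : 2 ≤ n)
    (hm : 1 ≤ m) :
    ∃ ρ : ℝ, 0 < ρ ∧ ρ < 1 ∧ 1 - 4 * M ≤ ρ ∧ ∀ K : ℕ, ∃ (d : ℕ) (P : Instance n m d μ L lam),
      ∀ (kind : OracleKind) (e : Execution kind P.f P.g P.x₀) (k : ℕ), e.commRounds k ≤ K →
        1 / 2 * (ρ ^ 2 * (ρ ^ 2) ^ (e.commRounds k + 1)) * ‖P.x₀ - P.xstar‖ ^ 2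
          ≤ ‖e.x k - P.xstar‖ ^ 2 := by
  have hM2 : M ^ 2 ≤ 1 / 100 := by nlinarith
  have hLμ : 0 < L - μ := pos_of_mul_pos_right (hμ.trans_le hLM) (sq_nonneg M)
  have hlam : 0 < lam := pos_of_mul_pos_right (hμ.trans_le hlamM) (sq_nonneg M)
  have hL : 50 * μ ≤ L := by nlinarith
  have hL0 : 0 < L := by linarith
  have hh1 : 0 < n / 2 := by omega
  have hh2 : n ≤ 3 * (n / 2) := by omega
  have hh1' : (0 : ℝ) < (n / 2 : ℕ) := by exact_mod_cast hh1
  have hh2' : (n : ℝ) ≤ 3 * (n / 2 : ℕ) := by exact_mod_cast hh2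
  have hn0 : 0 < n := by omega
  have hn' : (0 : ℝ) < n := by exact_mod_cast hn0
  -- Scales reach 2, so smoothness needs 2μ + 4A ≤ L; this holds with 4A = 24L/25 and 50μ ≤ L.
  obtain ⟨A, hA⟩ : ∃ A, A = 6 / 25 * L := ⟨_, rfl⟩
  have hA0 : 0 < A := by rw [hA]; positivity
  have hB0 : 0 < lam * (n / 2 : ℕ) / n := by positivity
  obtain ⟨ρ, σ, hρ0, hρσ, hσ1, hup, hdown, hsq⟩ := exists_chain_ratio hμ hA0 hB0
  have hρ1 : ρ < 1 := hρσ.trans hσ1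
  have hσ0 : 0 < σ := hρ0.trans hρσ
  refine ⟨ρ, hρ0, hρ1, ?_, fun K => ?_⟩
  · have tA : μ / A ≤ 25 / 6 * M ^ 2 := by
      rw [div_le_iff₀ hA0, hA]
      nlinarith
    have tB : μ / (lam * (n / 2 : ℕ) / n) ≤ 3 * M ^ 2 := by
      rw [div_le_iff₀ hB0, ← sub_nonneg]
      have : 3 * M ^ 2 * (lam * (n / 2 : ℕ) / n) - μ
          = (M ^ 2 * lam * (3 * (n / 2 : ℕ) - n) + (M ^ 2 * lam - μ) * n) / n := by
        field_simp
        ring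
      rw [this]
      have h1 : 0 ≤ 3 * ((n / 2 : ℕ) : ℝ) - n := by linarith
      have h2 : 0 ≤ M ^ 2 * lam - μ := by linarith
      positivity
    have tA0 : 0 < μ / A := by positivity
    have tAB : μ / A * (μ / (lam * (n / 2 : ℕ) / n)) ≤ 25 / 6 * M ^ 2 * (3 * M ^ 2) :=
      mul_le_mul tA tB (by positivity) (by positivity)
    -- The coefficients of M² add up to 25/3 + 6 + 25M²/2, which is below 16.
    have hs : (1 - ρ) ^ 2 ≤ (4 * M) ^ 2 := by
      rw [hsq]
      refine (mul_le_of_le_one_left (by positivity) hρ1.le).trans ?_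
      rw [mul_div_assoc, mul_div_assoc]
      nlinarith [mul_nonneg (sq_nonneg M) (sub_nonneg.2 hM2)]
    linarith [abs_le_of_sq_le_sq' hs (by positivity)]
  -- At least `N` coordinates must remain unseen after `K` rounds, so that their geometric sum is at
  -- least half of the whole one.
  obtain ⟨N, hN⟩ := exists_pow_lt_of_lt_one (half_pos one_pos) (show ρ ^ 2 < 1 by nlinarith)
  have hd0 : 0 < K + 1 + (N + 1) := by omega
  generalize hd : K + 1 + (N + 1) = d at hd0
  have hE0 : 0 ≤ A * (1 - ρ / σ) :=
    mul_nonneg hA0.le (sub_nonneg.2 ((div_le_one hσ0).2 hρσ.le))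
  have hE1 : A * (1 - ρ / σ) ≤ A := mul_le_of_le_one_right hA0.le (by
    have : 0 < ρ / σ := by positivity
    linarith)
  have hθ := clientScale_mem hn
  have hend := fun s => endCurvature_mem (d := d) (s := s) hA0.le hE0 hE1
  have hτ := fun i : Fin n => pairing_involutive d (clientKind i)
  have hα : ∀ i : Fin n, μ ≤ clientScale n (clientKind i) * μ := fun i =>
    le_mul_of_one_le_left hμ.le (hθ _).1
  have hθ0 : ∀ s, 0 ≤ clientScale n s := fun s => zero_le_one.trans (hθ s).1
  have ha : ∀ i : Fin n, 0 ≤ clientScale n (clientKind i) * A := fun i => mul_nonneg (hθ0 _) hA0.le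
  have hc : ∀ (i : Fin n) (j : Fin d), 0 ≤ clientScale n (clientKind i) *
      endCurvature d (clientKind i) A (A * (1 - ρ / σ)) j := fun i j =>
    mul_nonneg (hθ0 _) (hend _ j).1
  have hca : ∀ (i : Fin n) (j : Fin d), clientScale n (clientKind i) *
      endCurvature d (clientKind i) A (A * (1 - ρ / σ)) j
        ≤ 2 * (clientScale n (clientKind i) * A) := fun i j => by
    nlinarith [mul_le_mul_of_nonneg_left (hend (clientKind i) j).2 (hθ0 (clientKind i)), ha i]
  have hfix : ∀ (i : Fin n) (j : Fin d), pairing d (clientKind i) j ≠ j →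
      clientScale n (clientKind i) * endCurvature d (clientKind i) A (A * (1 - ρ / σ)) j = 0 :=
    fun i j hj => by rw [endCurvature_eq_zero hj, mul_zero]
  have hstart : (0 : Models n d) ≠ chainOptimum n d ρ σ := by
    intro h
    have h1 : (0 : ℝ) = ρ ^ 0 * _ := congrArg (fun x : Models n d => x ⟨0, hn0⟩ ⟨0, hd0⟩) h
    have h2 : (0 : ℝ) < if (0 + clientKind (⟨0, hn0⟩ : Fin n)) % 2 = 0 then σ else 1 := by
      split_ifs <;> linarith
    rw [pow_zero, one_mul] at h1
    exact h2.ne h1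
  obtain ⟨P, hP0, hPs, hPf, hPg⟩ := exists_matched_instance (m := m) (L := L) (by omega) hm hμ
    hlam.le hτ hα ha
    (fun i => by nlinarith [(hθ (clientKind i)).2]) hc hca hfix hstart
    (chainOptimum_stationary hn hρ0.ne' hσ0.ne' hup hdown)
  refine ⟨d, P, fun kind e k hk => ?_⟩
  -- The reach is the first cut from `C` on that splits no pair of the client. Hence the forced
  -- group sees coordinate 0 before any communication.
  have hmem := e.mem_prefixSpace (fun i => by rw [hP0]; rfl)
    (fun i C => if (C + clientKind i) % 2 = 0 then C else C + 1)
    (fun l i C => by split_ifs <;> omega)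
    (fun i C β j x hβ hx => by
      have hpar : ((if (C + clientKind i) % 2 = 0 then C else C + 1) + clientKind i) % 2 = 0 := by
        split_ifs <;> omega
      exact localOracle_matched_subset kind (hPf i) (hPg i) (hτ i) (hμ.le.trans (hα i)) (ha i)
        (hc i) (hca i) (hfix i) (le_pairing hpar)
        (fun j hj => by rw [startForce_eq_zero hpar j hj, mul_zero]) hβ j hx) k
  have hmem' : ∀ i, e.x k i ∈ prefixSpace d (e.commRounds k + 1) := fun i =>
    prefixSpace_mono (by split_ifs <;> omega) (hmem i)
  obtain ⟨d', hd'⟩ : ∃ d', d = (e.commRounds k + 1) + d' :=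
    ⟨d - (e.commRounds k + 1), by omega⟩
  have hdist : ‖P.x₀ - P.xstar‖ = ‖chainOptimum n d ρ σ‖ := by
    rw [hP0, hPs, zero_sub, norm_neg]
  rw [hdist, hPs]
  have hgeom := geom_sum_le_two_mul (sq_nonneg ρ) (by nlinarith) hN.le
    (show N ≤ d' by omega) d
  have hup' := norm_chainOptimum_sq_le (n := n) (d := d) hρ0 hσ0 hσ1
  have hlow : n * (ρ ^ 2 * (ρ ^ 2) ^ (e.commRounds k + 1) * ∑ j ∈ Finset.range d', (ρ ^ 2) ^ j)
      ≤ ‖e.x k - chainOptimum n d ρ σ‖ ^ 2 := by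
    have key : ∀ (D d₁ : ℕ) (x : Models n d₁), d₁ = D + d' →
        (∀ i, x i ∈ prefixSpace d₁ D) →
        n * (ρ ^ 2 * (ρ ^ 2) ^ D * ∑ j ∈ Finset.range d', (ρ ^ 2) ^ j)
          ≤ ‖x - chainOptimum n d₁ ρ σ‖ ^ 2 := by
      rintro D d₁ x rfl hx
      exact le_norm_sub_chainOptimum_sq hρ0 hρσ.le hσ1.le hx
    exact key _ _ _ hd' hmem'
  refine le_trans ?_ hlow
  calc _ ≤ 1 / 2 * (ρ ^ 2 * (ρ ^ 2) ^ (e.commRounds k + 1)) *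
        (n * (2 * ∑ j ∈ Finset.range d', (ρ ^ 2) ^ j)) :=
      mul_le_mul_of_nonneg_left
        (hup'.trans (mul_le_mul_of_nonneg_left hgeom hn'.le)) (by positivity)
    _ = _ := by ring

/-- The lower bound with the explicit rate, uniformly in the iterations with at most `K`
communication rounds. -/
theorem exists_instance_rate_le {μ L lam : ℝ} (hμ : 0 < μ) (hμL : μ < L) (hlam : 0 < lam)
    {n m : ℕ} (hn : 2 ≤ n) (hm : 1 ≤ m) (K : ℕ) :
    ∃ (d : ℕ) (P : Instance n m d μ L lam),
      ∀ (kind : OracleKind) (e : Execution kind P.f P.g P.x₀) (k : ℕ), e.commRounds k ≤ K →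
        1 / 4 * rate μ L lam ^ (e.commRounds k + 1) * ‖P.x₀ - P.xstar‖ ^ 2
          ≤ ‖e.x k - P.xstar‖ ^ 2 := by
  have hLμ : 0 < L - μ := sub_pos.2 hμL
  obtain ⟨M, hMdef⟩ : ∃ M, M = max (√(μ / lam)) (√(μ / (L - μ))) := ⟨_, rfl⟩
  have hM0 : 0 ≤ M := hMdef ▸ le_max_of_le_left (Real.sqrt_nonneg _)
  have hrate : rate μ L lam = max 0 (1 - 10 * M) := by rw [rate, hMdef]
  rw [hrate]
  rcases le_total M (1 / 10) with hM | hM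
  · have hsq : ∀ t, 0 < t → √(μ / t) ≤ M → μ ≤ M ^ 2 * t := fun t ht h => by
      rw [← div_le_iff₀ ht]
      exact Real.sqrt_le_iff.1 h |>.2
    obtain ⟨ρ, hρ0, hρ1, hρM, H⟩ := exists_hard_instance hμ hM0 hM
      (hsq lam hlam (hMdef ▸ le_max_left _ _)) (hsq (L - μ) hLμ (hMdef ▸ le_max_right _ _)) hn hm
    obtain ⟨d, P, hP⟩ := H K
    refine ⟨d, P, fun kind e k hk => le_trans ?_ (hP kind e k hk)⟩
    refine mul_le_mul_of_nonneg_right ?_ (sq_nonneg _)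
    rw [max_eq_right (by linarith)]
    have h1 : 0 ≤ 1 - 4 * M := by linarith
    have h2 : 1 - 8 * M ≤ ρ ^ 2 := by
      nlinarith [pow_le_pow_left₀ h1 hρM 2]
    have h3 : 1 - 10 * M ≤ ρ ^ 2 := by linarith
    -- Two spare factors ρ² are traded for one factor of the rate and the drop from 1/2 to 1/4. The
    -- polynomial 64M² - 11M + 1/2 has negative discriminant.
    have h4 : (1 - 10 * M) / 2 ≤ ρ ^ 2 * ρ ^ 2 := by
      have h5 : (1 - 8 * M) ^ 2 ≤ (ρ ^ 2) ^ 2 := pow_le_pow_left₀ (by linarith) h2 2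
      nlinarith [sq_nonneg (128 * M - 11)]
    have h6 : (1 - 10 * M) ^ e.commRounds k ≤ (ρ ^ 2) ^ e.commRounds k :=
      pow_le_pow_left₀ (by linarith) h3 _
    have h7 := mul_le_mul h6 h4 (by linarith) (by positivity)
    calc 1 / 4 * (1 - 10 * M) ^ (e.commRounds k + 1)
        = 1 / 2 * ((1 - 10 * M) ^ e.commRounds k * ((1 - 10 * M) / 2)) := by ring
      _ ≤ 1 / 2 * ((ρ ^ 2) ^ e.commRounds k * (ρ ^ 2 * ρ ^ 2)) := by linarith
      _ = _ := by ring
  -- Here the rate is 0, so any admissible instance works.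
  · have hst : (WithLp.toLp 2 fun _ => WithLp.toLp 2 fun _ => 1 : Models n 1) ≠ 0 := by
      intro h
      exact one_ne_zero (congrArg (fun x : Models n 1 => x ⟨0, by omega⟩ 0) h)
    obtain ⟨P, -⟩ := exists_matched_instance (n := n) (m := m) (d := 1) (μ := μ) (L := L)
      (τ := fun _ => id) (α := fun _ => μ) (a := fun _ => 0) (c := fun _ _ => 0)
      (b := fun _ _ => 0) (by omega) hm hμ hlam.le (fun _ _ => rfl) (fun _ => le_rfl)
      (fun _ => le_rfl) (fun _ => by linarith) (fun _ _ => le_rfl) (fun _ _ => by simp)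
      (fun _ _ _ => rfl) hst (fun i => by
        have : average (0 : Models n 1) = 0 := by simp [average]
        rw [this]
        ext j
        simp [matchedGrad])
    refine ⟨1, P, fun kind e k _ => ?_⟩
    rw [max_eq_left (by linarith), zero_pow (Nat.succ_ne_zero _), mul_zero, zero_mul]
    exact sq_nonneg _

/-- With T = √(min L lam / μ) ≥ 30, the log of the rate is at least -30/T. As 1/256 = (1/4)⁴, the
prefactor 1/4 uses up at most a quarter of log(1/ε). This leaves C + 1 ≥ T log(1/ε)/40, and half of
the right side absorbs the 1. -/
theorem le_of_quarter_rate_pow_le {μ L lam ε : ℝ} (hμ : 0 < μ) (hκ : 900 * μ ≤ min L lam)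
    (hε : 0 < ε) (hε0 : ε ≤ 1 / 256) {C : ℕ} (h : 1 / 4 * rate μ L lam ^ (C + 1) ≤ ε) :
    1 / 80 * √(min L lam / μ) * Real.log (1 / ε) ≤ C := by
  obtain ⟨T, hT⟩ : ∃ T, T = √(min L lam / μ) := ⟨_, rfl⟩
  have hTsq : T ^ 2 = min L lam / μ := by
    rw [hT]
    exact Real.sq_sqrt (div_nonneg (by linarith) hμ.le)
  have hT30 : 30 ≤ T := by
    rw [hT]
    refine Real.le_sqrt_of_sq_le ?_
    rw [le_div_iff₀ hμ]
    linarith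
  have hTμ : T ^ 2 * μ = min L lam := by
    rw [hTsq]
    field_simp
  have hTL : T ^ 2 * μ ≤ L := hTμ.trans_le (min_le_left _ _)
  have hTlam : T ^ 2 * μ ≤ lam := hTμ.trans_le (min_le_right _ _)
  have hT0 : 0 < T := by linarith
  have hbound : ∀ t, T ^ 2 * μ ≤ t + μ → √(μ / t) ≤ 3 / 2 / T := fun t ht => by
    have ht0 : 0 < t := by nlinarith
    refine Real.sqrt_le_iff.2 ⟨by positivity, ?_⟩
    rw [div_pow, div_le_div_iff₀ ht0 (by positivity)]
    nlinarith
  have hr : 1 - 15 / T ≤ rate μ L lam := by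
    refine le_trans ?_ (le_max_right _ _)
    have := max_le (hbound lam (by linarith)) (hbound (L - μ) (by linarith))
    have e : 15 / T = 10 * (3 / 2 / T) := by ring
    linarith
  have h15 : 15 / T ≤ 1 / 2 := by
    rw [div_le_iff₀ hT0]
    linarith
  have hr0 : 0 < rate μ L lam := by linarith
  have hlogr : -(30 / T) ≤ Real.log (rate μ L lam) := by
    have h1 := Real.one_sub_inv_le_log_of_pos hr0
    have h2 : (rate μ L lam)⁻¹ ≤ 1 + 30 / T := by
      rw [inv_le_iff_one_le_mul₀ hr0]
      have e : 30 / T = 2 * (15 / T) := by ring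
      have : 0 < 15 / T := by positivity
      rw [e]
      nlinarith
    linarith
  have hlog := Real.log_le_log (by positivity) h
  rw [Real.log_mul (by norm_num) (by positivity), Real.log_pow] at hlog
  rw [← hT, one_div ε, Real.log_inv]
  have hlog4 : Real.log (1 / 4) = -(2 * Real.log 2) := by
    rw [show (1 / 4 : ℝ) = (2 ^ 2)⁻¹ by norm_num, Real.log_inv, Real.log_pow]
    norm_num
  have hlogε : Real.log ε ≤ -(8 * Real.log 2) := by
    refine (Real.log_le_log hε hε0).trans_eq ?_
    rw [show (1 / 256 : ℝ) = (2 ^ 8)⁻¹ by norm_num, Real.log_inv, Real.log_pow]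
    norm_num
  have hl2 := Real.log_two_gt_d9
  rw [hlog4] at hlog
  push_cast at hlog
  have h1 : -((C + 1) * (30 / T)) ≤ ((C : ℝ) + 1) * Real.log (rate μ L lam) := by
    have : (0 : ℝ) ≤ C + 1 := by positivity
    nlinarith
  have h2 : 3 / 4 * -Real.log ε ≤ (C + 1) * (30 / T) := by linarith
  have h3 : 3 / 4 * -Real.log ε * T ≤ (C + 1) * 30 := by
    have := mul_le_mul_of_nonneg_right h2 hT0.le
    rwa [mul_assoc ((C : ℝ) + 1), div_mul_cancel₀ _ hT0.ne'] at this
  have h4 : 30 * 5 ≤ T * -Real.log ε :=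
    mul_le_mul hT30 (by linarith) (by norm_num) hT0.le
  linarith

end PersonalizedFL

end

theorem mainTheorem7 :
    (∀ (μ L lam : ℝ), 0 < μ → μ < L → μ ≤ lam →
      ∀ (n m k : ℕ), 2 ≤ n → 1 ≤ m →
        ∃ (d : ℕ) (P : PersonalizedFL.Instance n m d μ L lam),
          ∀ (kind : PersonalizedFL.OracleKind)
            (e : PersonalizedFL.Execution kind P.f P.g P.x₀),
            1 / 4 * PersonalizedFL.rate μ L lam ^ (e.commRounds k + 1) * ‖P.x₀ - P.xstar‖ ^ 2
              ≤ ‖e.x k - P.xstar‖ ^ 2) ∧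
    (∃ c κ ε₀ : ℝ, 0 < c ∧ 1 < κ ∧ 0 < ε₀ ∧ ε₀ < 1 ∧
      ∀ (μ L lam : ℝ), 0 < μ → κ * μ ≤ min L lam →
        ∀ (n m : ℕ), 2 ≤ n → 1 ≤ m → ∀ ε : ℝ, 0 < ε → ε ≤ ε₀ →
          ∃ (d : ℕ) (P : PersonalizedFL.Instance n m d μ L lam),
            ∀ (kind : PersonalizedFL.OracleKind)
              (e : PersonalizedFL.Execution kind P.f P.g P.x₀) (k : ℕ),
              ‖e.x k - P.xstar‖ ^ 2 ≤ ε * ‖P.x₀ - P.xstar‖ ^ 2 →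
                c * √(min L lam / μ) * Real.log (1 / ε) ≤ (e.commRounds k : ℝ)) := by
  refine ⟨fun μ L lam hμ hμL hlam n m k hn hm => ?_, 1 / 80, 900, 1 / 256, by norm_num,
    by norm_num, by norm_num, by norm_num, fun μ L lam hμ hκ n m hn hm ε hε hε0 => ?_⟩
  · obtain ⟨d, P, hP⟩ :=
      PersonalizedFL.exists_instance_rate_le hμ hμL (hμ.trans_le hlam) hn hm k
    exact ⟨d, P, fun kind e => hP kind e k (e.commRounds_le k)⟩
  · have hL : 900 * μ ≤ L := hκ.trans (min_le_left _ _)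
    have hlam : 900 * μ ≤ lam := hκ.trans (min_le_right _ _)
    -- The instance must not depend on `k`, so its size is set by the claimed number of rounds: a
    -- counterexample would use fewer.
    obtain ⟨d, P, hP⟩ := PersonalizedFL.exists_instance_rate_le hμ (by linarith : μ < L)
      (by linarith : 0 < lam) hn hm ⌈1 / 80 * √(min L lam / μ) * Real.log (1 / ε)⌉₊
    refine ⟨d, P, fun kind e k hk => ?_⟩
    by_contra! hC
    have hpos : 0 < ‖P.x₀ - P.xstar‖ ^ 2 :=
      pow_pos (norm_pos_iff.2 (sub_ne_zero.2 P.start_ne)) 2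
    have hCK : e.commRounds k ≤ ⌈1 / 80 * √(min L lam / μ) * Real.log (1 / ε)⌉₊ := by
      exact_mod_cast hC.le.trans (Nat.le_ceil _)
    have h := le_of_mul_le_mul_right ((hP kind e k hCK).trans hk) hpos
    exact hC.not_ge (PersonalizedFL.le_of_quarter_rate_pow_le hμ hκ hε hε0 h)
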